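/- \textbf{Model.} A market consists of sellers $x_1,\dots,x_n\in\mathbb R^d$ and buyers $y_1,\dots,y_n\in\mathbb R^d$; the edge between seller $i$ and buyer $j$ has weight $\|x_i-y_j\|_2$. Seller $i$ is in the market at the integer times $t$ with $a_i\le t<d_i$, where $a_i\ge 0$ is its arrival time ($a_i=0$: present at initialization) and $d_i>a_i$ its deadline. Buyer $j$ arrives at an integer time $b_j\ge 1$; the $b_j$ are distinct. A matching up to time $T$ is an injective partial map from sellers to buyers such that a buyer $j$ matched with a seller $i$ satisfies $b_j\le T$ and $a_i\le b_j<d_i$; its weight is the sum of the weights of its edges. \textbf{FastGreedy.} Given $\epsilon$ and $\delta$, take a sketch dimension $s$ of order $\epsilon^{-2}\log(n/\delta)$ and sample $M\in\mathbb R^{s\times d}$ with independent entries, equal to $\pm 1/\sqrt s$ with probability $1/2$ each. Start with value $w_i=0$ and no mate for each seller $i$, and $p=0$. At each time, sellers whose deadline is reached leave and arriving sellers enter. If a buyer $j$ then arrives and some seller is in the market, put $\widetilde w_i=\|My_j-Mx_i\|_2$, choose a seller $i_0$ in the market that maximizes $\widetilde w_i-w_i$ (ties are broken arbitrarily), make $j$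 the mate of $i_0$ (replacing its previous mate) if $\widetilde w_{i_0}\ge w_{i_0}$, increase $p$ by $\max\{w_{i_0},\widetilde w_{i_0}\}-w_{i_0}$, and set $w_{i_0}\leftarrow\max\{w_{i_0},\widetilde w_{i_0}\}$. \textbf{Theorem.} For precision $\epsilon\in(0,0.1)$, FastGreedy is $\frac{1-\epsilon}{2}$-competitive with probability at least $1-\delta$. Precisely: there is an absolute constant $C>0$ such that for all $\epsilon\in(0,0.1)$, $\delta\in(0,1)$, all $n,d$, all integers $s\ge C\epsilon^{-2}\log(n/\delta)$ (no condition on $s$ if $n=0$), and every market as above, with probability at least $1-\delta$ over $M$ the following holds for every tie-breaking and every time $T$: the mates recorded by FastGreedy after time $T$ form a matching up to time $T$, and both the weight of this matching (with the true weights $\|x_i-y_j\|_2$) and the total matching value $p$ returned by FastGreedy are at least $\frac{1-\epsilon}{2}\,\mathrm{opt}_T$, where $\mathrm{opt}_T$ is the maximum weight of a matching up to time $T$. -/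

import Mathlib

open MeasureTheory

namespace OnlineMatching

/-- An instance of the online bipartite market with deadlines: `n` sellers and `n` buyers, all of
them points of `ℝ^d`. Time `0` is the initialization; a seller with `sellerTime i = 0` is offline,
i.e. in the market from the start. Seller `i` can be matched at the times `t` with
`sellerTime i ≤ t < deadline i`. Buyers arrive one after another at positive times. -/
structure Market (n d : ℕ) where
  x : Fin n → EuclideanSpace ℝ (Fin d)
  y : Fin n → EuclideanSpace ℝ (Fin d)
  sellerTime : Fin n → ℕ
  buyerTime : Fin n → ℕ
  deadline : Fin n → ℕ
  sellerTime_lt_deadline : ∀ i, sellerTime i < deadline i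
  buyerTime_pos : ∀ j, 0 < buyerTime j
  buyerTime_injective : Function.Injective buyerTime

namespace Market

variable {n d : ℕ}

/-- The weight of the edge between seller `i` and buyer `j`. -/
noncomputable def weight (I : Market n d) (i j : Fin n) : ℝ := ‖I.x i - I.y j‖

/-- A matching of the sellers and buyers seen up to time `T`: a partial injective function from
sellers to buyers, each matched buyer having arrived by time `T`, at a time at which its seller is
in the market. -/
def IsMatching (I : Market n d) (T : ℕ) (m : Fin n → Option (Fin n)) : Prop :=
  (∀ i j, m i = some j →
    I.buyerTime j ≤ T ∧ I.sellerTime i ≤ I.buyerTime j ∧ I.buyerTime j < I.deadline i) ∧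
  ∀ i i' j, m i = some j → m i' = some j → i = i'

/-- The total (true) weight of a matching. -/
noncomputable def matchingWeight (I : Market n d) (m : Fin n → Option (Fin n)) : ℝ :=
  ∑ i, (m i).elim 0 (I.weight i)

end Market

/-- The memory of the algorithm: `flag i` says whether seller `i` can be matched now, `mate i` is
the buyer currently matched with `i`, `w i` is the current matching value on `i`, and `p` is the
total matching value, which is what `TotalWeight` returns. -/
structure State (n : ℕ) where
  flag : Fin n → Bool
  mate : Fin n → Option (Fin n)
  w : Fin n → ℝ
  p : ℝ

/-- A way of computing `arg max` over nonempty sets of sellers, with an arbitrary (possibly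
time-dependent) tie-breaking. -/
def IsArgmaxRule {n : ℕ} (sel : ℕ → Finset (Fin n) → (Fin n → ℝ) → Fin n) : Prop :=
  ∀ (t : ℕ) (F : Finset (Fin n)) (f : Fin n → ℝ), F.Nonempty →
    sel t F f ∈ F ∧ ∀ i ∈ F, f i ≤ f (sel t F f)

theorem exists_isArgmaxRule (n : ℕ) :
    ∃ sel : ℕ → Finset (Fin (n + 1)) → (Fin (n + 1) → ℝ) → Fin (n + 1), IsArgmaxRule sel := by
  classical
  refine ⟨fun _ F f => if h : F.Nonempty then (F.exists_max_image f h).choose else 0, ?_⟩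
  intro t F f h
  simp only [h, dif_pos]
  exact (F.exists_max_image f h).choose_spec

namespace FastGreedy

variable {n d s : ℕ}

/-- The sketched weight `‖M y_j - M x_i‖`, as returned by `Query`. -/
noncomputable def query (M : Matrix (Fin s) (Fin d) ℝ) (I : Market n d) (j i : Fin n) : ℝ :=
  ‖M.toEuclideanLin (I.y j) - M.toEuclideanLin (I.x i)‖

/-- The state after `Init`. -/
def init (I : Market n d) : State n where
  flag i := decide (I.sellerTime i = 0)
  mate _ := none
  w _ := 0
  p := 0

/-- The flags at time `t`: deadlines are enforced, then arriving sellers enter the market. -/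
def setFlags (I : Market n d) (t : ℕ) (σ : State n) : State n :=
  { σ with flag := fun i =>
      if I.sellerTime i = t then true else if I.deadline i = t then false else σ.flag i }

/-- The treatment of an arriving buyer `j`. With `i₀` a seller in the market that maximizes
`query M I j i - w i`, the value of `i₀` becomes the maximum of the old value and the sketched
weight, and `j` becomes the mate of `i₀` unless that would decrease the value. -/
noncomputable def serve (M : Matrix (Fin s) (Fin d) ℝ) (I : Market n d)
    (sel : ℕ → Finset (Fin n) → (Fin n → ℝ) → Fin n) (t : ℕ) (j : Fin n) (σ : State n) :
    State n :=
  let F : Finset (Fin n) := Finset.univ.filter fun i => σ.flag i = true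
  let i₀ : Fin n := sel t F fun i => query M I j i - σ.w i
  if F.Nonempty then
    { flag := σ.flag
      mate := if σ.w i₀ ≤ query M I j i₀ then Function.update σ.mate i₀ (some j) else σ.mate
      w := Function.update σ.w i₀ (max (σ.w i₀) (query M I j i₀))
      p := σ.p + (max (σ.w i₀) (query M I j i₀) - σ.w i₀) }
  else σ

open Classical in
/-- Everything that happens at time `t`; at most one buyer arrives. -/
noncomputable def update (M : Matrix (Fin s) (Fin d) ℝ) (I : Market n d)
    (sel : ℕ → Finset (Fin n) → (Fin n → ℝ) → Fin n) (t : ℕ) (σ : State n) : State n :=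
  if h : ∃ j, I.buyerTime j = t then serve M I sel t h.choose (setFlags I t σ)
  else setFlags I t σ

/-- The state of `FastGreedy` with sketching matrix `M` after the events of the times `1, …, T`. -/
noncomputable def run (M : Matrix (Fin s) (Fin d) ℝ) (I : Market n d)
    (sel : ℕ → Finset (Fin n) → (Fin n → ℝ) → Fin n) : ℕ → State n
  | 0 => init I
  | T + 1 => update M I sel (T + 1) (run M I sel T)

/-- The law of `s * d` independent fair coins. -/
noncomputable def coins (s d : ℕ) : Measure (Fin s × Fin d → Bool) :=
  Measure.pi fun _ => (PMF.uniformOfFintype Bool).toMeasure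

/-- The sketching matrix with entries `±1/√s` given by the coins. -/
noncomputable def sketch (ω : Fin s × Fin d → Bool) : Matrix (Fin s) (Fin d) ℝ :=
  Matrix.of fun a b => if ω (a, b) = true then 1 / √(s : ℝ) else -(1 / √(s : ℝ))

end FastGreedy

end OnlineMatching

/-! A deterministic and a probabilistic fact combine. Greedy is primal-dual for the sketched
weights: the values `w i` and the gains `g j` form a feasible dual solution of the assignment
problem, and each family sums to `p`, so every matching has sketched weight at most `2 * p`
(`Invariant`, `IsMatching.sum_le_of_dual`). As `p` is also the sketched weight of the recorded
mates, distortion of all edges by factors within `1 ± ε / 2` yields both bounds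
(`competitive_of_distortion`).

For a fixed `z ≠ 0`, `‖M z‖² / ‖z‖²` is an average of `s` independent squares of subgaussian
Rademacher sums of variance one. Chernoff bounds each tail by `exp (-(s * ε ^ 2 / 640)) ≤ (δ / n) ^
3`, and a union bound over two tails of `n ^ 2` edges leaves `2 * δ ^ 3 / n`. This suffices for `n ≥
2`; for `n = 1` only the lower tail matters. The good event depends on `M` alone, so it serves all
tie-breakings and times at once. -/

namespace OnlineMatching

/-! ### Chernoff bounds for sums of squares of subgaussian variables. -/

open ProbabilityTheory Real

theorem one_div_sqrt_one_sub_le_exp {x : ℝ} (hx : 0 ≤ x) (hx' : x ≤ 1 / 2) :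
    (√(1 - x))⁻¹ ≤ exp (x / 2 + x ^ 2 / 2) := by
  have h1 : 0 < 1 - x := by linarith
  have h2 : 1 ≤ (1 - x) * exp (x + x ^ 2) := by
    have h3 := Real.quadratic_le_exp_of_nonneg (x := x + x ^ 2) (by positivity)
    have h4 := mul_le_mul_of_nonneg_left h3 h1.le
    refine le_trans ?_ h4
    have : (1 - x) * (1 + (x + x ^ 2) + (x + x ^ 2) ^ 2 / 2) - 1
        = x ^ 2 * ((1 - x) * (1 + x) ^ 2 / 2 - x) := by ring
    have h5 : 0 ≤ (1 - x) * (1 + x) ^ 2 / 2 - x := by nlinarith [mul_nonneg hx hx]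
    nlinarith [mul_nonneg (sq_nonneg x) h5]
  rw [← Real.sqrt_inv]
  refine Real.sqrt_le_iff.2 ⟨(exp_pos _).le, ?_⟩
  rw [← Real.exp_nat_mul, inv_le_iff_one_le_mul₀' h1]
  rwa [show ((2 : ℕ) : ℝ) * (x / 2 + x ^ 2 / 2) = x + x ^ 2 by push_cast; ring]

theorem exp_neg_le_quadratic {u : ℝ} (hu : 0 ≤ u) : exp (-u) ≤ 1 - u + u ^ 2 / 2 := by
  have h1 := Real.quadratic_le_exp_of_nonneg hu
  rw [Real.exp_neg, inv_le_iff_one_le_mul₀ (exp_pos _)]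
  have h2 : 0 ≤ 1 - u + u ^ 2 / 2 := by nlinarith [sq_nonneg (u - 1)]
  nlinarith [mul_le_mul_of_nonneg_left h1 h2, sq_nonneg (u ^ 2)]

theorem integral_exp_mul_sq_gaussianReal {l : ℝ} (hl : l < 1 / 2) :
    ∫ x, exp (l * x ^ 2) ∂(gaussianReal 0 1) = (√(1 - 2 * l))⁻¹ := by
  rw [integral_gaussianReal_eq_integral_smul one_ne_zero]
  simp only [gaussianPDFReal_def, smul_eq_mul, NNReal.coe_one, mul_one, sub_zero]
  have h : ∀ x : ℝ, (√(2 * π))⁻¹ * exp (-x ^ 2 / 2) * exp (l * x ^ 2)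
      = (√(2 * π))⁻¹ * exp (-(1 / 2 - l) * x ^ 2) := by
    intro x
    rw [mul_assoc, ← exp_add]
    congr 2
    ring
  simp_rw [h]
  rw [integral_const_mul, integral_gaussian, ← Real.sqrt_inv, ← Real.sqrt_inv,
    ← Real.sqrt_mul (by positivity)]
  congr 1
  have : 1 / 2 - l ≠ 0 := by linarith
  have : 1 - 2 * l ≠ 0 := by linarith
  field_simp

section Subgaussian

variable {Ω : Type*} [Fintype Ω] [MeasurableSpace Ω] [MeasurableSingletonClass Ω]
  {μ : Measure Ω} [IsProbabilityMeasure μ] {X : Ω → ℝ}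

/-- Gaussian linearization: `exp (l * x ^ 2)` is the mean of `exp (√(2 * l) * g * x)` over a
standard Gaussian `g`. Exchanging the two means and bounding the inner one for fixed `g` replaces
`X` by `g`, whose square has an explicit mgf. -/
theorem mgf_sq_le_of_hasSubgaussianMGF (hX : HasSubgaussianMGF X 1 μ) {l : ℝ} (hl : 0 ≤ l)
    (hl' : l ≤ 1 / 4) : mgf (fun ω => X ω ^ 2) μ l ≤ exp (l + 2 * l ^ 2) := by
  set γ := gaussianReal 0 1
  have hexp : ∀ t : ℝ, ∫ x, exp (t * x) ∂γ = exp (t ^ 2 / 2) := by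
    intro t
    have := congrFun (mgf_id_gaussianReal (μ := 0) (v := 1)) t
    simpa [mgf] using this
  -- A nonzero integral certifies integrability, since non-integrable functions have integral `0` by
  -- convention.
  have hint : ∀ t : ℝ, Integrable (fun x => exp (t * x)) γ := fun t =>
    .of_integral_ne_zero (by rw [hexp]; positivity)
  have hsq : 2 * l = √(2 * l) ^ 2 := (Real.sq_sqrt (by positivity)).symm
  have h1 : mgf (fun ω => X ω ^ 2) μ l = ∫ x, mgf X μ (√(2 * l) * x) ∂γ := by
    simp only [mgf, integral_fintype (Integrable.of_finite), smul_eq_mul]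
    rw [integral_finsetSum]
    · refine Finset.sum_congr rfl fun ω _ => ?_
      rw [integral_const_mul]
      have h2 : ∀ x, √(2 * l) * x * X ω = (√(2 * l) * X ω) * x := fun x => by ring
      simp_rw [h2, hexp, mul_pow, ← hsq]
      congr 2
      ring
    · intro ω _
      have h2 : ∀ x, √(2 * l) * x * X ω = (√(2 * l) * X ω) * x := fun x => by ring
      simp_rw [h2]
      exact (hint _).const_mul _
  have hl2 : 0 < √(1 - 2 * l) := Real.sqrt_pos.2 (by linarith)
  rw [h1]
  calc ∫ x, mgf X μ (√(2 * l) * x) ∂γ ≤ ∫ x, exp (l * x ^ 2) ∂γ := by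
        refine integral_mono_of_nonneg (ae_of_all _ fun x => mgf_nonneg) ?_ (ae_of_all _ fun x => ?_)
        · refine .of_integral_ne_zero ?_
          rw [integral_exp_mul_sq_gaussianReal (by linarith)]
          positivity
        · refine (hX.mgf_le _).trans_eq ?_
          rw [mul_pow, ← hsq]
          congr 1
          push_cast
          ring
    _ = (√(1 - 2 * l))⁻¹ := integral_exp_mul_sq_gaussianReal (by linarith)
    _ ≤ exp (l + 2 * l ^ 2) := by
        refine (one_div_sqrt_one_sub_le_exp (by positivity) (by linarith)).trans_eq ?_
        congr 1
        ring

/-- From `x ^ 4 / 4! ≤ exp |x| ≤ exp x + exp (-x)`; the constant is `48 * exp (1 / 2) ≤ 80`. -/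
theorem integral_pow_four_le_of_hasSubgaussianMGF (hX : HasSubgaussianMGF X 1 μ) :
    ∫ ω, X ω ^ 4 ∂μ ≤ 80 := by
  have h1 : ∀ ω, X ω ^ 4 ≤ 24 * (exp (1 * X ω) + exp (-1 * X ω)) := by
    intro ω
    have h2 := Real.pow_div_factorial_le_exp |X ω| (abs_nonneg _) 4
    have h3 := Real.exp_abs_le (X ω)
    rw [show |X ω| ^ 4 = X ω ^ 4 from Even.pow_abs (by decide) _] at h2
    norm_num [Nat.factorial] at h2 ⊢
    linarith
  have h2 := hX.mgf_le 1
  have h3 := hX.mgf_le (-1)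
  have h4 : exp ((1 : ℝ) / 2) ≤ 5 / 3 := by
    have h5 := Real.exp_one_lt_d9
    have h6 : exp ((1 : ℝ) / 2) ^ 2 = exp 1 := by rw [← Real.exp_nat_mul]; norm_num
    nlinarith [exp_pos ((1 : ℝ) / 2)]
  norm_num at h2 h3
  norm_num at h4
  calc ∫ ω, X ω ^ 4 ∂μ ≤ ∫ ω, 24 * (exp (1 * X ω) + exp (-1 * X ω)) ∂μ :=
        integral_mono .of_finite .of_finite h1
    _ = 24 * (mgf X μ 1 + mgf X μ (-1)) := by
        rw [integral_const_mul, integral_add .of_finite .of_finite]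
        rfl
    _ ≤ 80 := by linarith

/-- The second-order bound on `exp (-u)` holds for all `u ≥ 0`, so the second and fourth moments of
`X` suffice. -/
theorem mgf_sq_neg_le_of_hasSubgaussianMGF (hX : HasSubgaussianMGF X 1 μ)
    (hX2 : ∫ ω, X ω ^ 2 ∂μ = 1) {l : ℝ} (hl : 0 ≤ l) :
    mgf (fun ω => X ω ^ 2) μ (-l) ≤ exp (-l + 40 * l ^ 2) := by
  have h1 : ∀ ω, exp (-l * X ω ^ 2) ≤ 1 + (-l * X ω ^ 2 + l ^ 2 / 2 * X ω ^ 4) := by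
    intro ω
    have := exp_neg_le_quadratic (u := l * X ω ^ 2) (by positivity)
    rw [neg_mul]
    refine this.trans_eq ?_
    ring
  calc mgf (fun ω => X ω ^ 2) μ (-l)
      ≤ ∫ ω, (1 + (-l * X ω ^ 2 + l ^ 2 / 2 * X ω ^ 4)) ∂μ :=
        integral_mono .of_finite .of_finite h1
    _ = 1 + (-l + l ^ 2 / 2 * ∫ ω, X ω ^ 4 ∂μ) := by
        rw [integral_add .of_finite .of_finite, integral_add .of_finite .of_finite,
          integral_const_mul, integral_const_mul, hX2]
        simp
    _ ≤ (-l + 40 * l ^ 2) + 1 := by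
        nlinarith [integral_pow_four_le_of_hasSubgaussianMGF hX, sq_nonneg l]
    _ ≤ _ := Real.add_one_le_exp _

variable {ι : Type*} [Fintype ι]

omit [Fintype Ω] [MeasurableSingletonClass Ω] in
theorem mgf_sum_pi (f : Ω → ℝ) (t : ℝ) :
    mgf (fun r : ι → Ω => ∑ a, f (r a)) (Measure.pi fun _ => μ) t
      = mgf f μ t ^ Fintype.card ι := by
  simp only [mgf, Finset.mul_sum, Real.exp_sum]
  exact integral_fintype_prod_eq_pow (fun x => exp (t * f x))

theorem measure_sum_sq_ge_le (hX : HasSubgaussianMGF X 1 μ) {α : ℝ} (hα : 0 ≤ α) (hα' : α ≤ 1) :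
    (Measure.pi fun _ : ι => μ).real {r | (1 + α) * Fintype.card ι ≤ ∑ a, X (r a) ^ 2}
      ≤ exp (-(Fintype.card ι * α ^ 2 / 8)) := by
  have h1 := measure_ge_le_exp_mul_mgf (μ := Measure.pi fun _ : ι => μ)
    -- This `t` minimizes `-α * t + 2 * t ^ 2`; `α ≤ 1` keeps it below `1 / 4`.
    (X := fun r => ∑ a, X (r a) ^ 2) (t := α / 4) ((1 + α) * Fintype.card ι) (by positivity)
    .of_finite
  refine h1.trans ?_
  rw [mgf_sum_pi (fun x => X x ^ 2)]
  calc _ ≤ exp (-(α / 4) * ((1 + α) * Fintype.card ι)) *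
        exp (α / 4 + 2 * (α / 4) ^ 2) ^ Fintype.card ι := by
        gcongr
        · exact mgf_nonneg
        · exact mgf_sq_le_of_hasSubgaussianMGF hX (by positivity) (by linarith)
    _ = _ := by
        rw [← Real.exp_nat_mul, ← Real.exp_add]
        congr 1
        ring

theorem measure_sum_sq_le_le (hX : HasSubgaussianMGF X 1 μ) (hX2 : ∫ ω, X ω ^ 2 ∂μ = 1) {α : ℝ}
    (hα : 0 ≤ α) :
    (Measure.pi fun _ : ι => μ).real {r | ∑ a, X (r a) ^ 2 ≤ (1 - α) * Fintype.card ι}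
      ≤ exp (-(Fintype.card ι * α ^ 2 / 160)) := by
  have h1 := measure_le_le_exp_mul_mgf (μ := Measure.pi fun _ : ι => μ)
    -- With `l = -t`, this minimizes `-α * l + 40 * l ^ 2`.
    (X := fun r => ∑ a, X (r a) ^ 2) (t := -(α / 80)) ((1 - α) * Fintype.card ι)
    (by linarith) .of_finite
  refine h1.trans ?_
  rw [mgf_sum_pi (fun x => X x ^ 2)]
  calc _ ≤ exp (-(-(α / 80)) * ((1 - α) * Fintype.card ι)) *
        exp (-(α / 80) + 40 * (α / 80) ^ 2) ^ Fintype.card ι := by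
        gcongr
        · exact mgf_nonneg
        · exact mgf_sq_neg_le_of_hasSubgaussianMGF hX hX2 (by positivity)
    _ = _ := by
        rw [← Real.exp_nat_mul, ← Real.exp_add]
        congr 1
        ring

end Subgaussian

/-! ### Rademacher sums: subgaussianity and variance. -/

/-- The law of a fair coin. -/
noncomputable abbrev coin : Measure Bool := (PMF.uniformOfFintype Bool).toMeasure

/-- The value `±1` of a coin. -/
def sign (c : Bool) : ℝ := if c then 1 else -1

theorem integral_coin (f : Bool → ℝ) : ∫ c, f c ∂coin = (f true + f false) / 2 := by
  rw [integral_fintype .of_finite]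
  simp [Measure.real]
  ring

section Rademacher

variable {ι : Type*} [Fintype ι]

/-- The Rademacher sum with coefficients `z`. -/
noncomputable def rademacherSum (z : ι → ℝ) (r : ι → Bool) : ℝ := ∑ b, sign (r b) * z b

theorem iIndepFun_sign_mul (z : ι → ℝ) :
    iIndepFun (fun b (r : ι → Bool) => sign (r b) * z b) (Measure.pi fun _ => coin) :=
  iIndepFun_pi (X := fun b c => sign c * z b) fun _ => (measurable_of_finite _).aemeasurable

theorem integral_eval_coin (f : Bool → ℝ) (b : ι) :
    ∫ r, f (r b) ∂(Measure.pi fun _ : ι => coin) = (f true + f false) / 2 := by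
  have h := integral_map (μ := Measure.pi fun _ : ι => coin) (measurable_pi_apply b).aemeasurable
    (measurable_of_finite f).aestronglyMeasurable
  have h' : (Measure.pi fun _ : ι => coin).map (fun r => r b) = coin :=
    (measurePreserving_eval (fun _ : ι => coin) b).map_eq
  rw [h', integral_coin] at h
  exact h.symm

/-- Hoeffding's lemma: a term in `[-|z b|, |z b|]` has variance proxy `z b ^ 2`, and proxies add by
independence. -/
theorem hasSubgaussianMGF_rademacherSum {z : ι → ℝ} (hz : ∑ b, z b ^ 2 = 1) :
    HasSubgaussianMGF (rademacherSum z) 1 (Measure.pi fun _ => coin) := by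
  have h := HasSubgaussianMGF.sum_of_iIndepFun (iIndepFun_sign_mul z)
    (c := fun b => (‖|z b| - -|z b|‖₊ / 2) ^ 2) (s := Finset.univ) (fun b _ =>
      hasSubgaussianMGF_of_mem_Icc_of_integral_eq_zero (measurable_of_finite _).aemeasurable
        (ae_of_all _ fun r => by
          have : |sign (r b) * z b| ≤ |z b| := by
            unfold sign
            split_ifs <;> simp
          exact abs_le.1 this)
        (by rw [integral_eval_coin (fun c => sign c * z b)]; simp [sign]))
  suffices hc : ∑ b, (‖|z b| - -|z b|‖₊ / 2) ^ 2 = 1 by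
    rw [hc] at h
    exact h
  ext
  push_cast
  rw [← hz]
  refine Finset.sum_congr rfl fun b _ => ?_
  rw [sub_neg_eq_add, ← two_mul, norm_mul, Real.norm_eq_abs |z b|, abs_abs]
  norm_num

theorem integral_rademacherSum_sq (z : ι → ℝ) :
    ∫ r, rademacherSum z r ^ 2 ∂(Measure.pi fun _ => coin) = ∑ b, z b ^ 2 := by
  classical
  have h1 : ∀ r, rademacherSum z r ^ 2
      = ∑ b, ∑ c, z b * z c * (sign (r b) * sign (r c)) := by
    intro r
    rw [rademacherSum, sq, Finset.sum_mul_sum]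
    refine Finset.sum_congr rfl fun b _ => Finset.sum_congr rfl fun c _ => by ring
  have h2 : ∀ b c, ∫ r, sign (r b) * sign (r c) ∂(Measure.pi fun _ : ι => coin)
      = if b = c then 1 else 0 := by
    intro b c
    split_ifs with hbc
    · subst hbc
      rw [integral_eval_coin (fun x => sign x * sign x)]
      simp [sign]
    · have h3 := (iIndepFun_pi (μ := fun _ : ι => coin) (X := fun _ => sign)
        (fun _ => (measurable_of_finite _).aemeasurable)).indepFun hbc
      have h4 := h3.integral_mul_eq_mul_integral
        (measurable_of_finite _).aestronglyMeasurable (measurable_of_finite _).aestronglyMeasurable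
      simp only [Pi.mul_apply] at h4
      rw [h4, integral_eval_coin sign b]
      simp [sign]
  simp_rw [h1]
  rw [integral_finsetSum _ fun _ _ => .of_finite]
  refine Finset.sum_congr rfl fun b _ => ?_
  rw [integral_finsetSum _ fun _ _ => .of_finite]
  simp_rw [integral_const_mul, h2]
  simp [sq]

end Rademacher

/-! ### Norm distortion of a fixed vector under the sketch. -/

namespace FastGreedy

variable {d s : ℕ}

instance : IsProbabilityMeasure (coins s d) := by
  unfold coins
  infer_instance

theorem measurePreserving_curry_coins :
    MeasurePreserving (fun (ω : Fin s × Fin d → Bool) a b => ω (a, b)) (coins s d)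
      (Measure.pi fun _ => Measure.pi fun _ => coin) := by
  refine ⟨measurable_of_finite _, ?_⟩
  refine Measure.ext_of_singleton fun r => ?_
  rw [Measure.map_apply (measurable_of_finite _) (measurableSet_singleton r), Measure.pi_singleton]
  have h1 : (fun (ω : Fin s × Fin d → Bool) a b => ω (a, b)) ⁻¹' {r}
      = {fun p => r p.1 p.2} := by
    ext ω
    simp only [Set.mem_preimage, Set.mem_singleton_iff, funext_iff, Prod.forall]
  rw [h1, coins, Measure.pi_singleton, Fintype.prod_prod_type]
  simp_rw [Measure.pi_singleton]

theorem norm_sketch_sq (ω : Fin s × Fin d → Bool) (z : EuclideanSpace ℝ (Fin d)) :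
    ‖(sketch ω).toEuclideanLin z‖ ^ 2
      = (s : ℝ)⁻¹ * ∑ a, rademacherSum z (fun b => ω (a, b)) ^ 2 := by
  rw [EuclideanSpace.norm_sq_eq, Finset.mul_sum]
  refine Finset.sum_congr rfl fun a _ => ?_
  have h1 : (sketch ω).toEuclideanLin z a
      = (√(s : ℝ))⁻¹ * rademacherSum z (fun b => ω (a, b)) := by
    rw [Matrix.toLpLin_apply, rademacherSum, Finset.mul_sum]
    change ∑ b, sketch ω a b * z b = _
    refine Finset.sum_congr rfl fun b _ => ?_
    simp only [sketch, Matrix.of_apply, sign]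
    split_ifs <;> ring
  rw [h1, Real.norm_eq_abs, sq_abs, mul_pow, inv_pow, Real.sq_sqrt (Nat.cast_nonneg _)]

theorem rademacherSum_smul {ι : Type*} [Fintype ι] (c : ℝ) (z : ι → ℝ) (r : ι → Bool) :
    rademacherSum (fun b => c * z b) r = c * rademacherSum z r := by
  simp only [rademacherSum, Finset.mul_sum]
  exact Finset.sum_congr rfl fun b _ => by ring

/-- The squared distortion of a nonzero vector is an average of squares of Rademacher sums with
normalized coefficients. -/
theorem exists_norm_sketch_sq_eq {z : EuclideanSpace ℝ (Fin d)} (hz : z ≠ 0) :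
    ∃ u : Fin d → ℝ, ∑ b, u b ^ 2 = 1 ∧ ∀ ω : Fin s × Fin d → Bool,
      ‖(sketch ω).toEuclideanLin z‖ ^ 2
        = ‖z‖ ^ 2 * ((s : ℝ)⁻¹ * ∑ a, rademacherSum u (fun b => ω (a, b)) ^ 2) := by
  have hz' : ‖z‖ ≠ 0 := norm_ne_zero_iff.2 hz
  refine ⟨fun b => ‖z‖⁻¹ * z b, ?_, fun ω => ?_⟩
  · have h := EuclideanSpace.norm_sq_eq z
    simp only [Real.norm_eq_abs, sq_abs] at h
    simp_rw [mul_pow]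
    rw [← Finset.mul_sum, ← h, ← mul_pow, inv_mul_cancel₀ hz', one_pow]
  · rw [norm_sketch_sq]
    simp_rw [rademacherSum_smul, mul_pow]
    rw [← Finset.mul_sum]
    field_simp

theorem coins_norm_sketch_gt_le (hs : 0 < s) (z : EuclideanSpace ℝ (Fin d)) {α : ℝ} (hα : 0 ≤ α)
    (hα' : α ≤ 1) :
    (coins s d).real {ω | (1 + α) * ‖z‖ < ‖(sketch ω).toEuclideanLin z‖}
      ≤ exp (-(s * α ^ 2 / 8)) := by
  rcases eq_or_ne z 0 with rfl | hz
  · simp [(exp_pos _).le]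
  obtain ⟨u, hu, hnorm⟩ := exists_norm_sketch_sq_eq (s := s) hz
  have h := measure_sum_sq_ge_le (ι := Fin s) (hasSubgaussianMGF_rademacherSum hu) hα hα'
  rw [Fintype.card_fin, ← measurePreserving_curry_coins.measureReal_preimage
    (Set.toFinite _).measurableSet.nullMeasurableSet] at h
  refine (measureReal_mono fun ω hω => ?_).trans h
  have hz' : 0 < ‖z‖ := norm_pos_iff.2 hz
  have hs' : (0 : ℝ) < s := Nat.cast_pos.2 hs
  have h1 : ((1 + α) * ‖z‖) ^ 2 < ‖(sketch ω).toEuclideanLin z‖ ^ 2 :=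
    pow_lt_pow_left₀ hω (by positivity) two_ne_zero
  rw [hnorm, mul_pow, mul_comm, mul_lt_mul_iff_right₀ (by positivity), lt_inv_mul_iff₀ hs'] at h1
  simp only [Set.mem_preimage, Set.mem_ofPred_eq]
  -- Passing from norms to squares uses `(1 + α) ^ 2 ≥ 1 + α`.
  nlinarith [mul_nonneg hs'.le hα, mul_nonneg (mul_nonneg hs'.le hα) hα]

theorem coins_norm_sketch_lt_le (hs : 0 < s) (z : EuclideanSpace ℝ (Fin d)) {α : ℝ} (hα : 0 ≤ α)
    (hα' : α ≤ 1) :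
    (coins s d).real {ω | ‖(sketch ω).toEuclideanLin z‖ < (1 - α) * ‖z‖}
      ≤ exp (-(s * α ^ 2 / 160)) := by
  rcases eq_or_ne z 0 with rfl | hz
  · simp [(exp_pos _).le]
  obtain ⟨u, hu, hnorm⟩ := exists_norm_sketch_sq_eq (s := s) hz
  have h := measure_sum_sq_le_le (ι := Fin s) (hasSubgaussianMGF_rademacherSum hu)
    ((integral_rademacherSum_sq u).trans hu) hα
  rw [Fintype.card_fin, ← measurePreserving_curry_coins.measureReal_preimage
    (Set.toFinite _).measurableSet.nullMeasurableSet] at h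
  refine (measureReal_mono fun ω hω => ?_).trans h
  have hz' : 0 < ‖z‖ := norm_pos_iff.2 hz
  have hs' : (0 : ℝ) < s := Nat.cast_pos.2 hs
  have h1 : ‖(sketch ω).toEuclideanLin z‖ ^ 2 < ((1 - α) * ‖z‖) ^ 2 :=
    pow_lt_pow_left₀ hω (norm_nonneg _) two_ne_zero
  rw [hnorm, mul_pow, mul_comm ((1 - α) ^ 2), mul_lt_mul_iff_right₀ (by positivity),
    inv_mul_lt_iff₀ hs'] at h1
  simp only [Set.mem_preimage, Set.mem_ofPred_eq]
  -- Here `α ≤ 1` gives `(1 - α) ^ 2 ≤ 1 - α`.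
  nlinarith [mul_nonneg hs'.le (mul_nonneg hα (sub_nonneg.2 hα'))]

end FastGreedy

end OnlineMatching

/-! ### Weak duality and the primal-dual analysis of greedy. -/

namespace OnlineMatching

namespace Market

variable {n d : ℕ}

/-- Seller `i` is in the market when buyer `j` arrives. -/
def IsFeasible (I : Market n d) (i j : Fin n) : Prop :=
  I.sellerTime i ≤ I.buyerTime j ∧ I.buyerTime j < I.deadline i

/-- Weak duality for the assignment problem with arbitrary edge weights. -/
theorem IsMatching.sum_le_of_dual {I : Market n d} {T : ℕ} {m : Fin n → Option (Fin n)}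
    (hm : I.IsMatching T m) {q : Fin n → Fin n → ℝ} {u v : Fin n → ℝ}
    (hu : ∀ i, 0 ≤ u i) (hv : ∀ j, 0 ≤ v j)
    (h : ∀ i j, I.buyerTime j ≤ T → I.IsFeasible i j → q i j ≤ u i + v j) :
    ∑ i, (m i).elim 0 (q i) ≤ ∑ i, u i + ∑ j, v j := by
  classical
  have h1 : ∀ i, (m i).elim 0 (q i) ≤ u i + (m i).elim 0 v := by
    intro i
    cases hi : m i with
    | none => simpa using hu i
    | some j => exact h i j (hm.1 i j hi).1 (hm.1 i j hi).2
  have h2 : ∑ i, (m i).elim 0 v ≤ ∑ j, v j := by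
    have h3 : ∀ i, (m i).elim 0 v = ∑ j, if m i = some j then v j else 0 := by
      intro i
      cases hi : m i with
      | none => simp
      | some j => simp
    simp_rw [h3]
    rw [Finset.sum_comm]
    refine Finset.sum_le_sum fun j _ => ?_
    by_cases hj : ∃ i, m i = some j
    · obtain ⟨i, hi⟩ := hj
      rw [Finset.sum_eq_single i]
      · simp [hi]
      · intro i' _ hne
        rw [if_neg]
        exact fun hi' => hne (hm.2 i' i j hi' hi)
      · simp
    · push Not at hj
      simpa [hj] using hv j
  calc ∑ i, (m i).elim 0 (q i) ≤ ∑ i, (u i + (m i).elim 0 v) :=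
        Finset.sum_le_sum fun i _ => h1 i
    _ = ∑ i, u i + ∑ i, (m i).elim 0 v := Finset.sum_add_distrib
    _ ≤ _ := by gcongr

end Market

namespace FastGreedy

variable {n d s : ℕ}

/-- What is true of the memory of the algorithm after the events of time `T`; `g j` is the amount
by which buyer `j` increased the total matching value. -/
structure Invariant (M : Matrix (Fin s) (Fin d) ℝ) (I : Market n d) (T : ℕ) (σ : State n)
    (g : Fin n → ℝ) : Prop where
  flag_iff : ∀ i, σ.flag i = true ↔ I.sellerTime i ≤ T ∧ T < I.deadline i
  isMatching : I.IsMatching T σ.mate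
  w_eq : ∀ i, σ.w i = (σ.mate i).elim 0 fun j => query M I j i
  sum_w : ∑ i, σ.w i = σ.p
  sum_g : ∑ j, g j = σ.p
  g_nonneg : ∀ j, 0 ≤ g j
  g_eq_zero : ∀ j, T < I.buyerTime j → g j = 0
  -- Dual feasibility, with dual variables `σ.w` and `g`.
  query_le : ∀ i j, I.buyerTime j ≤ T → I.IsFeasible i j → query M I j i ≤ σ.w i + g j

theorem query_nonneg (M : Matrix (Fin s) (Fin d) ℝ) (I : Market n d) (j i : Fin n) :
    0 ≤ query M I j i := norm_nonneg _

theorem Invariant.w_nonneg {M : Matrix (Fin s) (Fin d) ℝ} {I : Market n d} {T : ℕ} {σ : State n}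
    {g : Fin n → ℝ} (h : Invariant M I T σ g) (i : Fin n) : 0 ≤ σ.w i := by
  rw [h.w_eq]
  cases σ.mate i with
  | none => exact le_rfl
  | some j => exact query_nonneg M I j i

theorem invariant_init (M : Matrix (Fin s) (Fin d) ℝ) (I : Market n d) :
    Invariant M I 0 (init I) 0 where
  flag_iff i := by
    have := I.sellerTime_lt_deadline i
    simp only [init, decide_eq_true_eq]
    omega
  isMatching := by simp [init, Market.IsMatching]
  w_eq i := rfl
  sum_w := by simp [init]
  sum_g := by simp [init]
  g_nonneg _ := le_rfl
  g_eq_zero _ _ := rfl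
  query_le i j hj _ := absurd (I.buyerTime_pos j) (by omega)

theorem setFlags_flag_iff {M : Matrix (Fin s) (Fin d) ℝ} {I : Market n d} {T : ℕ} {σ : State n}
    {g : Fin n → ℝ} (h : Invariant M I T σ g) (i : Fin n) :
    (setFlags I (T + 1) σ).flag i = true ↔
      I.sellerTime i ≤ T + 1 ∧ T + 1 < I.deadline i := by
  have h1 := I.sellerTime_lt_deadline i
  have h2 := h.flag_iff i
  simp only [setFlags]
  split_ifs
  · simp; omega
  · simp; omega
  · rw [h2]; omega

/-- The invariant at a time at which no buyer is served. -/
theorem Invariant.idle {M : Matrix (Fin s) (Fin d) ℝ} {I : Market n d} {T : ℕ} {σ : State n}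
    {g : Fin n → ℝ} (h : Invariant M I T σ g)
    (hT : ∀ i j, I.buyerTime j = T + 1 → ¬ I.IsFeasible i j) :
    Invariant M I (T + 1) (setFlags I (T + 1) σ) g where
  flag_iff := setFlags_flag_iff h
  isMatching := ⟨fun i j hij => ⟨(h.isMatching.1 i j hij).1.trans (Nat.le_succ T),
    (h.isMatching.1 i j hij).2⟩, h.isMatching.2⟩
  w_eq := h.w_eq
  sum_w := h.sum_w
  sum_g := h.sum_g
  g_nonneg := h.g_nonneg
  g_eq_zero j hj := h.g_eq_zero j (by omega)
  query_le i j hj hij := by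
    rcases Nat.le_succ_iff.1 hj with hj' | hj'
    · exact h.query_le i j hj' hij
    · exact absurd hij (hT i j hj')

/-- The invariant after raising the value of a seller that maximizes the gain. -/
theorem Invariant.raise {M : Matrix (Fin s) (Fin d) ℝ} {I : Market n d} {T : ℕ} {σ τ : State n}
    {g : Fin n → ℝ} (h : Invariant M I T σ g) {i₀ j : Fin n} (hj : I.buyerTime j = T + 1)
    (hmax : ∀ i, I.IsFeasible i j → query M I j i - σ.w i ≤ query M I j i₀ - σ.w i₀)
    (hflag : τ.flag = (setFlags I (T + 1) σ).flag)
    (hw : τ.w = Function.update σ.w i₀ (max (σ.w i₀) (query M I j i₀)))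
    (hp : τ.p = σ.p + (max (σ.w i₀) (query M I j i₀) - σ.w i₀))
    (hmate : I.IsMatching (T + 1) τ.mate)
    (hwmate : ∀ i, τ.w i = (τ.mate i).elim 0 fun j => query M I j i) :
    Invariant M I (T + 1) τ
      (Function.update g j (max (σ.w i₀) (query M I j i₀) - σ.w i₀)) where
  flag_iff := by rw [hflag]; exact setFlags_flag_iff h
  isMatching := hmate
  w_eq := hwmate
  sum_w := by
    rw [hw, hp, Finset.sum_update_of_mem (Finset.mem_univ _), ← h.sum_w,
      ← Finset.add_sum_erase _ _ (Finset.mem_univ i₀), Finset.sdiff_singleton_eq_erase]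
    ring
  -- Overwriting `g j` loses nothing: it was `0`, as `j` arrives only now.
  sum_g := by
    rw [hp, Finset.sum_update_of_mem (Finset.mem_univ _), ← h.sum_g,
      ← Finset.add_sum_erase _ _ (Finset.mem_univ j), Finset.sdiff_singleton_eq_erase,
      h.g_eq_zero j (by omega)]
    ring
  g_nonneg j' := by
    rcases eq_or_ne j' j with rfl | hne
    · simp
    · simpa [hne] using h.g_nonneg j'
  g_eq_zero j' hj' := by
    rw [Function.update_of_ne (by rintro rfl; omega)]
    exact h.g_eq_zero j' (by omega)
  query_le i j' hj' hij := by
    have hwle : σ.w i ≤ τ.w i := by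
      rw [hw]
      rcases eq_or_ne i i₀ with rfl | hne
      · simp
      · simp [hne]
    rcases eq_or_ne j' j with rfl | hne
    -- The gain of the maximizer is at least `query M I j i - σ.w i`, so the new constraints hold.
    -- The old ones survive because values never decrease.
    · have h1 := hmax i hij
      have h2 := le_max_right (σ.w i₀) (query M I j' i₀)
      rw [Function.update_self]
      linarith
    · rw [Function.update_of_ne hne]
      have hne' : I.buyerTime j' ≠ T + 1 := fun h' =>
        hne (I.buyerTime_injective (h'.trans hj.symm))
      have h1 := h.query_le i j' (by omega) hij
      linarith

theorem Invariant.isMatching_update {M : Matrix (Fin s) (Fin d) ℝ} {I : Market n d} {T : ℕ}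
    {σ : State n} {g : Fin n → ℝ} (h : Invariant M I T σ g) {i₀ j : Fin n}
    (hj : I.buyerTime j = T + 1) (hfeas : I.IsFeasible i₀ j) :
    I.IsMatching (T + 1) (Function.update σ.mate i₀ (some j)) := by
  refine ⟨?_, ?_⟩
  · intro i j' hij
    rcases eq_or_ne i i₀ with rfl | hne
    · rw [Function.update_self] at hij
      obtain rfl := Option.some.inj hij
      exact ⟨hj.le, hfeas⟩
    · rw [Function.update_of_ne hne] at hij
      exact ⟨(h.isMatching.1 i j' hij).1.trans (Nat.le_succ T), (h.isMatching.1 i j' hij).2⟩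
  -- All earlier mates arrived by time `T`, so the new buyer is nobody's mate yet.
  · have hold : ∀ i, σ.mate i ≠ some j := fun i hi => by
      have := (h.isMatching.1 i j hi).1
      omega
    intro i i' j' hi hi'
    rcases eq_or_ne i i₀ with h1 | h1 <;> rcases eq_or_ne i' i₀ with h2 | h2
    · rw [h1, h2]
    · rw [h1, Function.update_self] at hi
      rw [Function.update_of_ne h2, ← hi] at hi'
      exact absurd hi' (hold i')
    · rw [h2, Function.update_self] at hi'
      rw [Function.update_of_ne h1, ← hi'] at hi
      exact absurd hi (hold i)
    · rw [Function.update_of_ne h1] at hi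
      rw [Function.update_of_ne h2] at hi'
      exact h.isMatching.2 i i' j' hi hi'

theorem Invariant.serve {M : Matrix (Fin s) (Fin d) ℝ} {I : Market n d} {T : ℕ} {σ : State n}
    {g : Fin n → ℝ} (h : Invariant M I T σ g)
    {sel : ℕ → Finset (Fin n) → (Fin n → ℝ) → Fin n} (hsel : IsArgmaxRule sel)
    {j : Fin n} (hj : I.buyerTime j = T + 1) :
    ∃ g', Invariant M I (T + 1)
      (FastGreedy.serve M I sel (T + 1) j (setFlags I (T + 1) σ)) g' := by
  have hflag : ∀ i, (setFlags I (T + 1) σ).flag i = true ↔ I.IsFeasible i j := by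
    intro i
    rw [Market.IsFeasible, hj]
    exact setFlags_flag_iff h i
  unfold FastGreedy.serve
  by_cases hF : (Finset.univ.filter fun i => (setFlags I (T + 1) σ).flag i = true).Nonempty
  · obtain ⟨hmem, hmax⟩ := hsel (T + 1) _ (fun i => query M I j i - σ.w i) hF
    dsimp only
    rw [if_pos hF]
    have hw : (setFlags I (T + 1) σ).w = σ.w := rfl
    have hmate : (setFlags I (T + 1) σ).mate = σ.mate := rfl
    have hp : (setFlags I (T + 1) σ).p = σ.p := rfl
    simp only [hw, hmate, hp]
    generalize sel (T + 1) (Finset.univ.filter fun i => (setFlags I (T + 1) σ).flag i = true)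
      (fun i => query M I j i - σ.w i) = i₀ at *
    have hfeas : I.IsFeasible i₀ j := by simpa [hflag] using hmem
    refine ⟨_, h.raise hj (i₀ := i₀) (fun i hi => hmax i (by simpa [hflag] using hi)) rfl rfl rfl
      ?_ fun i => ?_⟩
    · dsimp only
      split_ifs with hq
      · exact h.isMatching_update hj hfeas
      · exact ⟨fun i j' hij => ⟨(h.isMatching.1 i j' hij).1.trans (Nat.le_succ T),
          (h.isMatching.1 i j' hij).2⟩, h.isMatching.2⟩
    · dsimp only
      split_ifs with hq
      · rcases eq_or_ne i i₀ with rfl | h1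
        · exact (Function.update_self _ _ _).trans
            ((max_eq_right hq).trans (by simp))
        · refine (Function.update_of_ne h1 _ _).trans ?_
          rw [Function.update_of_ne h1]
          exact h.w_eq i
      -- A rejected buyer changes neither the mate nor the value.
      · refine Eq.trans ?_ (h.w_eq i)
        exact congrFun ((congrArg _ (max_eq_left (not_le.1 hq).le)).trans
          (Function.update_eq_self _ _)) i
  · dsimp only
    rw [if_neg hF]
    refine ⟨g, h.idle fun i j' hj' hij => hF ⟨i, ?_⟩⟩
    obtain rfl := I.buyerTime_injective (hj'.trans hj.symm)
    simpa [hflag] using hij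

theorem exists_invariant_run (M : Matrix (Fin s) (Fin d) ℝ) (I : Market n d)
    {sel : ℕ → Finset (Fin n) → (Fin n → ℝ) → Fin n} (hsel : IsArgmaxRule sel) (T : ℕ) :
    ∃ g, Invariant M I T (run M I sel T) g := by
  induction T with
  | zero => exact ⟨0, invariant_init M I⟩
  | succ T ih =>
    obtain ⟨g, hg⟩ := ih
    rw [run, update]
    split_ifs with h
    · exact hg.serve hsel h.choose_spec
    · exact ⟨g, hg.idle fun _ j hj => absurd ⟨j, hj⟩ h⟩

/-- If the sketch distorts every edge weight by a factor between `a` and `b`, then `FastGreedy` is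
`(1 - ε) / 2`-competitive as soon as `a` is at least `1 - ε` and `(1 - ε) * b`. -/
theorem competitive_of_distortion {M : Matrix (Fin s) (Fin d) ℝ} {I : Market n d}
    {sel : ℕ → Finset (Fin n) → (Fin n → ℝ) → Fin n} (hsel : IsArgmaxRule sel) (T : ℕ)
    {ε a b : ℝ} (hb : 0 < b) (ha : 1 - ε ≤ a) (hab : (1 - ε) * b ≤ a)
    (hlow : ∀ i j, a * I.weight i j ≤ query M I j i)
    (hupp : ∀ i j, query M I j i ≤ b * I.weight i j) :
    I.IsMatching T (run M I sel T).mate ∧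
      ∀ m : Fin n → Option (Fin n), I.IsMatching T m →
        (1 - ε) / 2 * I.matchingWeight m ≤ I.matchingWeight (run M I sel T).mate ∧
        (1 - ε) / 2 * I.matchingWeight m ≤ (run M I sel T).p := by
  obtain ⟨g, hg⟩ := exists_invariant_run M I hsel T
  refine ⟨hg.isMatching, fun m hm => ?_⟩
  have hpos : ∀ m : Fin n → Option (Fin n), 0 ≤ I.matchingWeight m := fun m =>
    Finset.sum_nonneg fun i _ => by
      cases m i with
      | none => exact le_rfl
      | some j => exact norm_nonneg _
  have hdual := hm.sum_le_of_dual (q := fun i j => query M I j i) hg.w_nonneg hg.g_nonneg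
    hg.query_le
  rw [hg.sum_w, hg.sum_g] at hdual
  have h1 : a * I.matchingWeight m ≤ 2 * (run M I sel T).p := by
    refine le_trans ?_ (hdual.trans_eq (two_mul _).symm)
    rw [Market.matchingWeight, Finset.mul_sum]
    refine Finset.sum_le_sum fun i _ => ?_
    cases m i with
    | none => simp
    | some j => exact hlow i j
  have h2 : (run M I sel T).p ≤ b * I.matchingWeight (run M I sel T).mate := by
    rw [← hg.sum_w, Market.matchingWeight, Finset.mul_sum]
    refine Finset.sum_le_sum fun i _ => ?_
    rw [hg.w_eq]
    cases (run M I sel T).mate i with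
    | none => simp
    | some j => exact hupp i j
  constructor
  -- For `W` the true weight of the mates: `(1 - ε) * b * opt ≤ a * opt ≤ 2 * p ≤ 2 * b * W`; cancel
  -- `b`.
  · have h3 := mul_le_mul_of_nonneg_right hab (hpos m)
    refine le_of_mul_le_mul_left ?_ hb
    nlinarith
  · have h3 := mul_le_mul_of_nonneg_right ha (hpos m)
    linarith

end FastGreedy

end OnlineMatching

/-! ### Union bound over the edges. -/

namespace OnlineMatching

namespace FastGreedy

open Real

variable {n d s : ℕ}

theorem query_eq_norm (M : Matrix (Fin s) (Fin d) ℝ) (I : Market n d) (i j : Fin n) :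
    query M I j i = ‖M.toEuclideanLin (I.x i - I.y j)‖ := by
  rw [query, map_sub, norm_sub_rev]

/-- The coins for which the sketch shrinks the weight of the edge `e` below `1 - ε / 2` times it. -/
def shrinks (I : Market n d) (s : ℕ) (ε : ℝ) (e : Fin n × Fin n) : Set (Fin s × Fin d → Bool) :=
  {ω | query (sketch ω) I e.2 e.1 < (1 - ε / 2) * I.weight e.1 e.2}

/-- The coins for which the sketch stretches the weight of the edge `e` beyond `1 + ε / 2` times it. -/
def stretches (I : Market n d) (s : ℕ) (ε : ℝ) (e : Fin n × Fin n) :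
    Set (Fin s × Fin d → Bool) :=
  {ω | (1 + ε / 2) * I.weight e.1 e.2 < query (sketch ω) I e.2 e.1}

theorem coins_shrinks_le (hs : 0 < s) (I : Market n d) {ε : ℝ} (hε : 0 ≤ ε) (hε' : ε ≤ 2)
    (e : Fin n × Fin n) : (coins s d).real (shrinks I s ε e) ≤ exp (-(s * ε ^ 2 / 640)) := by
  have h := coins_norm_sketch_lt_le hs (I.x e.1 - I.y e.2) (α := ε / 2) (by linarith)
    (by linarith)
  simp_rw [← query_eq_norm] at h
  refine h.trans_eq ?_
  congr 1
  ring

theorem coins_stretches_le (hs : 0 < s) (I : Market n d) {ε : ℝ} (hε : 0 ≤ ε) (hε' : ε ≤ 2)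
    (e : Fin n × Fin n) : (coins s d).real (stretches I s ε e) ≤ exp (-(s * ε ^ 2 / 640)) := by
  have h := coins_norm_sketch_gt_le hs (I.x e.1 - I.y e.2) (α := ε / 2) (by linarith)
    (by linarith)
  simp_rw [← query_eq_norm] at h
  refine h.trans (exp_le_exp.2 ?_)
  have : 0 ≤ s * ε ^ 2 := by positivity
  linarith

/-- The event of the theorem. -/
def Competitive (I : Market n d) (s : ℕ) (ε : ℝ) : Set (Fin s × Fin d → Bool) :=
  {ω | ∀ (sel : ℕ → Finset (Fin n) → (Fin n → ℝ) → Fin n) (T : ℕ) (σ : State n),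
    IsArgmaxRule sel → σ = run (sketch ω) I sel T →
      I.IsMatching T σ.mate ∧
      ∀ m : Fin n → Option (Fin n), I.IsMatching T m →
        (1 - ε) / 2 * I.matchingWeight m ≤ I.matchingWeight σ.mate ∧
        (1 - ε) / 2 * I.matchingWeight m ≤ σ.p}

theorem mem_competitive {I : Market n d} {ε a b : ℝ} {ω : Fin s × Fin d → Bool} (hb : 0 < b)
    (ha : 1 - ε ≤ a) (hab : (1 - ε) * b ≤ a)
    (hlow : ∀ i j, a * I.weight i j ≤ query (sketch ω) I j i)
    (hupp : ∀ i j, query (sketch ω) I j i ≤ b * I.weight i j) : ω ∈ Competitive I s ε := by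
  rintro sel T σ hsel rfl
  exact competitive_of_distortion hsel T hb ha hab hlow hupp

theorem mem_competitive_of_forall_notMem {I : Market n d} {ε : ℝ} (hε : 0 ≤ ε)
    {ω : Fin s × Fin d → Bool} (h1 : ∀ e, ω ∉ shrinks I s ε e) (h2 : ∀ e, ω ∉ stretches I s ε e) :
    ω ∈ Competitive I s ε :=
  mem_competitive (a := 1 - ε / 2) (b := 1 + ε / 2) (by linarith) (by linarith) (by nlinarith)
    (fun i j => not_lt.1 (h1 (i, j))) (fun i j => not_lt.1 (h2 (i, j)))

/-- With a single edge, the algorithm cannot be hurt by a sketch that stretches it. -/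
theorem mem_competitive_of_notMem_shrinks {I : Market 1 d} {ε : ℝ} (hε : 0 ≤ ε) (hε' : ε < 1)
    {ω : Fin s × Fin d → Bool} (h1 : ω ∉ shrinks I s ε (0, 0)) : ω ∈ Competitive I s ε := by
  have h2 : (1 - ε / 2) * I.weight 0 0 ≤ query (sketch ω) I 0 0 := not_lt.1 h1
  -- The exact distortion of the only edge serves as both `a` and `b`, so no upper bound on it is
  -- needed.
  obtain ⟨a, ha, haq⟩ : ∃ a, 1 - ε ≤ a ∧ query (sketch ω) I 0 0 = a * I.weight 0 0 := by
    rcases eq_or_ne (I.weight 0 0) 0 with h0 | h0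
    · refine ⟨1, by linarith, ?_⟩
      have h3 : I.x 0 - I.y 0 = 0 := norm_eq_zero.1 h0
      rw [h0, query_eq_norm, h3, map_zero, norm_zero, mul_zero]
    · refine ⟨query (sketch ω) I 0 0 / I.weight 0 0, ?_, (div_mul_cancel₀ _ h0).symm⟩
      have hpos : 0 < I.weight 0 0 := (norm_nonneg _).lt_of_ne' h0
      rw [le_div_iff₀ hpos]
      nlinarith
  have ha0 : 0 < a := by linarith
  refine mem_competitive (a := a) (b := a) ha0 ha (by nlinarith) ?_ ?_
  · intro i j
    rw [Subsingleton.elim i 0, Subsingleton.elim j 0, haq]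
  · intro i j
    rw [Subsingleton.elim i 0, Subsingleton.elim j 0, haq]

theorem ofReal_one_sub_le_coins {A B : Set (Fin s × Fin d → Bool)} {δ : ℝ}
    (hB : (coins s d).real B ≤ δ) (h : Bᶜ ⊆ A) : ENNReal.ofReal (1 - δ) ≤ coins s d A := by
  rw [← ofReal_measureReal]
  refine ENNReal.ofReal_le_ofReal ?_
  have h1 := measureReal_mono (μ := coins s d) h
  rw [probReal_compl_eq_one_sub (Set.toFinite B).measurableSet] at h1
  linarith

/-- `1920 = 3 * 640`: of the three factors `1 / n`, two pay for the `n ^ 2` edges and the third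
absorbs the two tails. -/
theorem exp_neg_le_of_sketch_dim {ε δ : ℝ} (hε : 0 < ε) (hδ : 0 < δ) {n s : ℕ} (hn : 0 < n)
    (hs : 1920 * ε⁻¹ ^ 2 * log (n / δ) ≤ s) : exp (-(s * ε ^ 2 / 640)) ≤ (δ / n) ^ 3 := by
  have hn' : (0 : ℝ) < n := Nat.cast_pos.2 hn
  have h1 : (δ / n) ^ 3 = exp (-(3 * log (n / δ))) := by
    rw [← inv_div, inv_pow, exp_neg, ← exp_log (show (0 : ℝ) < n / δ by positivity),
      ← exp_nat_mul, log_exp]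
    norm_num
  rw [h1]
  refine exp_le_exp.2 (neg_le_neg ?_)
  have h2 := mul_le_mul_of_nonneg_right hs (sq_nonneg ε)
  have h3 : 1920 * ε⁻¹ ^ 2 * log (n / δ) * ε ^ 2 = 1920 * log (n / δ) := by
    field_simp
  rw [h3] at h2
  linarith

theorem coins_competitive {ε δ : ℝ} (hε : 0 < ε) (hε' : ε < 1) (hδ : 0 < δ) (hδ' : δ < 1)
    (hs : 1920 * ε⁻¹ ^ 2 * log (n / δ) ≤ s) (I : Market n d) :
    ENNReal.ofReal (1 - δ) ≤ coins s d (Competitive I s ε) := by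
  rcases Nat.eq_zero_or_pos n with rfl | hn
  -- There are no edges, and the event is certain even for `s = 0`.
  · refine ofReal_one_sub_le_coins (B := ∅) (by simpa using hδ.le) fun ω _ => ?_
    exact mem_competitive_of_forall_notMem hε.le (fun e => e.1.elim0) (fun e => e.1.elim0)
  have hn' : (1 : ℝ) ≤ n := Nat.one_le_cast.2 hn
  have hs0 : 0 < s := by
    have h1 : 0 < log (n / δ) := log_pos (by rw [lt_div_iff₀ hδ]; linarith)
    have h2 : (0 : ℝ) < s := lt_of_lt_of_le (by positivity) hs
    exact_mod_cast h2
  have hexp := exp_neg_le_of_sketch_dim hε hδ hn hs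
  have hδ3 : δ ^ 3 ≤ δ := pow_le_of_le_one hδ.le hδ'.le three_ne_zero
  rcases Nat.lt_or_ge n 2 with hn2 | hn2
  -- Two tails would cost `2 * δ ^ 3`, which can exceed `δ`; one tail does not.
  · obtain rfl : n = 1 := by omega
    refine ofReal_one_sub_le_coins (B := shrinks I s ε (0, 0)) ?_
      fun ω hω => mem_competitive_of_notMem_shrinks hε.le hε' hω
    refine (coins_shrinks_le hs0 I hε.le (by linarith) _).trans (hexp.trans ?_)
    simpa using hδ3
  · refine ofReal_one_sub_le_coins (B := ⋃ e, (shrinks I s ε e ∪ stretches I s ε e)) ?_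
      fun ω hω => ?_
    · have hn2' : (2 : ℝ) ≤ n := by exact_mod_cast hn2
      calc (coins s d).real (⋃ e, (shrinks I s ε e ∪ stretches I s ε e))
          ≤ ∑ e, (coins s d).real (shrinks I s ε e ∪ stretches I s ε e) :=
            measureReal_iUnion_fintype_le _
        _ ≤ ∑ _e : Fin n × Fin n, ((δ / n) ^ 3 + (δ / n) ^ 3) := by
            refine Finset.sum_le_sum fun e _ => (measureReal_union_le _ _).trans (add_le_add ?_ ?_)
            · exact (coins_shrinks_le hs0 I hε.le (by linarith) e).trans hexp
            · exact (coins_stretches_le hs0 I hε.le (by linarith) e).trans hexp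
        _ = δ ^ 3 * (2 / n) := by
            rw [Finset.sum_const, Finset.card_univ, Fintype.card_prod, Fintype.card_fin]
            simp only [nsmul_eq_mul, Nat.cast_mul]
            field_simp
            ring
        _ ≤ δ ^ 3 * 1 := by
            gcongr
            exact (div_le_one (by linarith)).2 hn2'
        _ ≤ δ := by linarith
    · simp only [Set.mem_compl_iff, Set.mem_iUnion, Set.mem_union, not_exists, not_or] at hω
      exact mem_competitive_of_forall_notMem hε.le (fun e => (hω e).1) (fun e => (hω e).2)

end FastGreedy

end OnlineMatching

theorem mainTheorem1 :
    ∃ C : ℝ, 0 < C ∧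
      ∀ (ε δ : ℝ), 0 < ε → ε < 0.1 → 0 < δ → δ < 1 →
      ∀ (n d s : ℕ), C * ε⁻¹ ^ 2 * Real.log ((n : ℝ) / δ) ≤ (s : ℝ) →
      ∀ I : OnlineMatching.Market n d,
        ENNReal.ofReal (1 - δ) ≤ OnlineMatching.FastGreedy.coins s d
          {ω | ∀ (sel : ℕ → Finset (Fin n) → (Fin n → ℝ) → Fin n) (T : ℕ)
            (σ : OnlineMatching.State n),
            OnlineMatching.IsArgmaxRule sel →
            σ = OnlineMatching.FastGreedy.run (OnlineMatching.FastGreedy.sketch ω) I sel T →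
              I.IsMatching T σ.mate ∧
              ∀ m : Fin n → Option (Fin n), I.IsMatching T m →
                (1 - ε) / 2 * I.matchingWeight m ≤ I.matchingWeight σ.mate ∧
                (1 - ε) / 2 * I.matchingWeight m ≤ σ.p} := by
  refine ⟨1920, by norm_num, fun ε δ hε hε' hδ hδ' n d s hs I => ?_⟩
  exact OnlineMatching.FastGreedy.coins_competitive hε (hε'.trans (by norm_num)) hδ hδ' hs I
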